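/- All Banach spaces are real. For a Banach space $X$, let $\mathrm{Lip}_0(X)$ be the Banach space of Lipschitz functions $f:X\to\mathbb R$ with $f(0)=0$, normed by the Lipschitz constant; for $x\in X$ let $\delta_x\in \mathrm{Lip}_0(X)^*$ be the evaluation at $x$, and let $\mathfrak F(X)=\overline{\mathrm{span}}\{\delta_x: x\in X\}\subseteq \mathrm{Lip}_0(X)^*$ be the Lipschitz-free space. For a Banach space $Y$ and a Lipschitz map $f:X\to Y$ with $f(0)=0$, let $L_f:\mathfrak F(X)\to Y$ be the unique bounded linear operator with $L_f(\delta_x)=f(x)$ for all $x\in X$. If $M$ is a closed subspace of $X$, then $\mathfrak F(M)$ is identified with $\overline{\mathrm{span}}\{\delta_m: m\in M\}\subseteq\mathfrak F(X)$. A Banach space $X$ has the $\mathcal K$-BAP (respectively, the Lip-$\mathcal K$-BAP) if there is $\lambda\ge 1$ such that the identity of $X$ belongs to the closure, in the topology of uniform convergence on compact sets, of the set of compact linear operators $T:X\to X$ with $\|T\|\le\lambda$ (respectively, of the set of Lipschitz maps $f:X\to X$ with $f(0)=0$ and Lipschitz constant at most $\lambda$ for which $L_f$ is compact). A closed subspace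 $N$ of a Banach space $Z$ is an ideal in $Z$ if there is a bounded linear operator $\sigma:N^*\to Z^*$ such that, for every $\varphi\in N^*$, $\sigma(\varphi)$ extends $\varphi$ and $\|\sigma(\varphi)\|=\|\varphi\|$. The dual $X^*$ has the bounded weak-star density for compact operators (B$W^*$D) if there is $\lambda\ge1$ such that every compact operator $T:X^*\to X^*$ with $\|T\|\le1$ belongs to the closure, in the weak-star topology of $\mathcal L(X^*,X^*)=(X^*\widehat\otimes_\pi X)^*$, of the set of weak-star to weak-star continuous compact operators on $X^*$ of norm at most $\lambda$. **Proposition.** Let $X$ be a Banach space and let $M$ be a closed subspace of $X$ such that $\mathfrak F(M)$ is an ideal in $\mathfrak F(X)$. If $M$ has the Lip-$\mathcal K$-BAP, $\mathfrak F(X)/\mathfrak F(M)$ has the $\mathcal K$-BAP, and $X^*$ has the B$W^*$D, then $X$ has the Lip-$\mathcal K$-BAP. -/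

import Mathlib

open Topology

noncomputable section

namespace LipAP

section FreeSpace

variable (X : Type*) [NormedAddCommGroup X]

/-- The linear space underlying `Lip₀(X)`: real Lipschitz functions on `X` vanishing at `0`. -/
def lipSubmodule : Submodule ℝ (X → ℝ) where
  carrier := {f | f 0 = 0 ∧ ∃ C : ℝ, ∀ x y, ‖f x - f y‖ ≤ C * ‖x - y‖}
  zero_mem' := ⟨rfl, 0, by simp⟩
  add_mem' := by
    rintro f g ⟨hf, C, hC⟩ ⟨hg, D, hD⟩
    refine ⟨by simp [hf, hg], C + D, fun x y => ?_⟩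
    have h : (f + g) x - (f + g) y = (f x - f y) + (g x - g y) := by simp; ring
    rw [h, add_mul]
    exact (norm_add_le _ _).trans (add_le_add (hC x y) (hD x y))
  smul_mem' := by
    rintro c f ⟨hf, C, hC⟩
    refine ⟨by simp [hf], ‖c‖ * C, fun x y => ?_⟩
    have h : (c • f) x - (c • f) y = c * (f x - f y) := by simp; ring
    rw [h, norm_mul, mul_assoc]
    exact mul_le_mul_of_nonneg_left (hC x y) (norm_nonneg c)

/-- `Lip₀(X)`. A type synonym, so that it does not carry the topology of pointwise convergence. -/
def Lip0 : Type _ := lipSubmodule X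

namespace Lip0

section Core

/-- The pointwise addition of `Lip₀(X)`. -/
abbrev addCommGroup : AddCommGroup (Lip0 X) := inferInstanceAs (AddCommGroup (lipSubmodule X))

attribute [local instance] addCommGroup

/-- The pointwise scalar multiplication of `Lip₀(X)`. -/
abbrev module : Module ℝ (Lip0 X) := inferInstanceAs (Module ℝ (lipSubmodule X))

attribute [local instance] module

instance : FunLike (Lip0 X) X ℝ where
  coe f := f.1
  coe_injective _ _ h := Subtype.ext h

variable {X}

@[ext] theorem ext {f g : Lip0 X} (h : ∀ x, f x = g x) : f = g := DFunLike.ext _ _ h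

@[simp] theorem add_apply (f g : Lip0 X) (x : X) : (f + g) x = f x + g x := rfl

@[simp] theorem smul_apply (c : ℝ) (f : Lip0 X) (x : X) : (c • f) x = c * f x := rfl

@[simp] theorem zero_apply (x : X) : (0 : Lip0 X) x = 0 := rfl

@[simp] theorem map_zero (f : Lip0 X) : f 0 = 0 := f.2.1

theorem exists_bound (f : Lip0 X) : ∃ C : ℝ, ∀ x y, ‖f x - f y‖ ≤ C * ‖x - y‖ := f.2.2

/-- The Lipschitz norm, the supremum of `|f x - f y| / ‖x - y‖` (a pair `x = y` contributes `0`). -/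
instance : Norm (Lip0 X) := ⟨fun f => ⨆ p : X × X, ‖f p.1 - f p.2‖ / ‖p.1 - p.2‖⟩

theorem norm_def (f : Lip0 X) : ‖f‖ = ⨆ p : X × X, ‖f p.1 - f p.2‖ / ‖p.1 - p.2‖ := rfl

theorem bddAbove_slope (f : Lip0 X) :
    BddAbove (Set.range fun p : X × X => ‖f p.1 - f p.2‖ / ‖p.1 - p.2‖) := by
  obtain ⟨C, hC⟩ := f.exists_bound
  refine ⟨max C 0, ?_⟩
  rintro _ ⟨p, rfl⟩
  exact div_le_of_le_mul₀ (norm_nonneg _) (le_max_right _ _)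
    ((hC p.1 p.2).trans (mul_le_mul_of_nonneg_right (le_max_left _ _) (norm_nonneg _)))

theorem norm_nonneg' (f : Lip0 X) : 0 ≤ ‖f‖ :=
  Real.iSup_nonneg fun _ => div_nonneg (norm_nonneg _) (norm_nonneg _)

theorem norm_sub_le_norm_mul (f : Lip0 X) (x y : X) : ‖f x - f y‖ ≤ ‖f‖ * ‖x - y‖ := by
  rcases eq_or_ne x y with rfl | h
  · simp
  · have hp : 0 < ‖x - y‖ := norm_pos_iff.2 (sub_ne_zero.2 h)
    exact (div_le_iff₀ hp).1 (le_ciSup f.bddAbove_slope (x, y))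

theorem norm_le_of_bound (f : Lip0 X) {C : ℝ} (hC : 0 ≤ C)
    (h : ∀ x y, ‖f x - f y‖ ≤ C * ‖x - y‖) : ‖f‖ ≤ C :=
  Real.iSup_le (fun p => div_le_of_le_mul₀ (norm_nonneg _) hC (h p.1 p.2)) hC

theorem normedSpaceCore : NormedSpace.Core ℝ (Lip0 X) where
  norm_nonneg := norm_nonneg'
  norm_smul c f := by
    rw [norm_def, norm_def, Real.mul_iSup_of_nonneg (norm_nonneg c)]
    refine iSup_congr fun p => ?_
    rw [smul_apply, smul_apply, ← mul_sub, norm_mul, mul_div_assoc]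
  norm_triangle f g := by
    refine norm_le_of_bound _ (add_nonneg (norm_nonneg' f) (norm_nonneg' g)) fun x y => ?_
    have h : (f + g) x - (f + g) y = (f x - f y) + (g x - g y) := by simp; ring
    rw [h, add_mul]
    exact (norm_add_le _ _).trans
      (add_le_add (norm_sub_le_norm_mul f x y) (norm_sub_le_norm_mul g x y))
  norm_eq_zero_iff f := by
    constructor
    · intro h
      ext x
      have := norm_sub_le_norm_mul f x 0
      simpa [h] using this
    · rintro rfl
      exact le_antisymm (norm_le_of_bound _ le_rfl (by simp)) (norm_nonneg' _)

variable (X) in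
/-- The Banach space structure of `Lip₀(X)`. -/
abbrev normedAddCommGroup : NormedAddCommGroup (Lip0 X) :=
  NormedAddCommGroup.ofCore normedSpaceCore

attribute [local instance] normedAddCommGroup

variable (X) in
/-- The Banach space structure of `Lip₀(X)`. -/
abbrev normedSpace : NormedSpace ℝ (Lip0 X) := NormedSpace.ofCore normedSpaceCore

end Core

variable {X}

instance : NormedAddCommGroup (Lip0 X) := normedAddCommGroup X

instance : NormedSpace ℝ (Lip0 X) := normedSpace X

/-- The evaluation functional `f ↦ f x` in the dual of `Lip₀(X)`. -/
def eval (x : X) : StrongDual ℝ (Lip0 X) :=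
  LinearMap.mkContinuous
    { toFun := fun f => f x
      map_add' := fun _ _ => rfl
      map_smul' := fun _ _ => rfl } ‖x‖ fun f => by
    have h := norm_sub_le_norm_mul f x 0
    rw [map_zero, sub_zero, sub_zero, mul_comm] at h
    exact h

end Lip0

/-- The closed linear span of the evaluations in `Lip₀(X)*`. -/
def freeSubmodule : Submodule ℝ (StrongDual ℝ (Lip0 X)) :=
  (Submodule.span ℝ (Set.range (Lip0.eval (X := X)))).topologicalClosure

/-- The Lipschitz-free space `𝔉(X)`, with the norm of `Lip₀(X)*`. -/
def FreeSpace : Type _ := freeSubmodule X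

instance : NormedAddCommGroup (FreeSpace X) :=
  inferInstanceAs (NormedAddCommGroup (freeSubmodule X))

instance : NormedSpace ℝ (FreeSpace X) := inferInstanceAs (NormedSpace ℝ (freeSubmodule X))

variable {X}

/-- The canonical map `δ_X : X → 𝔉(X)`. -/
def delta (x : X) : FreeSpace X :=
  ⟨Lip0.eval x, Submodule.le_topologicalClosure _ (Submodule.subset_span ⟨x, rfl⟩)⟩

/-- `𝔉(M)` as a subspace of `𝔉(X)`: the closed linear span of `δ_m`, `m ∈ M`. -/
def freeSubspace [NormedSpace ℝ X] (M : Submodule ℝ X) : Submodule ℝ (FreeSpace X) :=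
  (Submodule.span ℝ (delta '' (M : Set X))).topologicalClosure

instance [NormedSpace ℝ X] (M : Submodule ℝ X) : IsClosed (freeSubspace M : Set (FreeSpace X)) :=
  Submodule.isClosed_topologicalClosure _

end FreeSpace

section Properties

variable (X : Type*) [NormedAddCommGroup X] [NormedSpace ℝ X]
variable (Y : Type*) [NormedAddCommGroup Y] [NormedSpace ℝ Y]

variable {X} in
/-- `M` is an ideal (is locally complemented) in `X`: there is a Hahn-Banach extension operator
`σ : M* → X*`. -/
def IsIdeal (M : Submodule ℝ X) : Prop :=
  ∃ σ : StrongDual ℝ M →L[ℝ] StrongDual ℝ X,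
    ∀ φ : StrongDual ℝ M, (∀ m : M, σ φ m = φ m) ∧ ‖σ φ‖ = ‖φ‖

/-- `𝒦^r(X, Y)`, the compact operators of norm at most `r`. -/
def compactOps (r : ℝ) : Set (X →L[ℝ] Y) :=
  {T | IsCompactOperator T ∧ ‖T‖ ≤ r}

/-- `Lip_𝒦^r(X, Y)`: the Lipschitz maps `f` with `f 0 = 0` and Lipschitz constant at most `r` whose
linearization `L_f : 𝔉(X) → Y`, the unique bounded operator with `L_f ∘ δ_X = f`, is compact. -/
def lipCompactMaps (r : ℝ) : Set C(X, Y) :=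
  {f | f 0 = 0 ∧ (∀ x y, ‖f x - f y‖ ≤ r * ‖x - y‖) ∧
    ∃ L : FreeSpace X →L[ℝ] Y, (∀ x, L (delta x) = f x) ∧ IsCompactOperator L}

/-- The `𝒦`-bounded approximation property; `C(X, X)` carries the compact-open topology. -/
def HasKBAP : Prop :=
  ∃ r : ℝ, 1 ≤ r ∧
    ContinuousMap.id X ∈ closure ((fun T : X →L[ℝ] X => (T : C(X, X))) '' compactOps X X r)

/-- The Lipschitz `𝒦`-bounded approximation property. -/
def HasLipKBAP : Prop :=
  ∃ r : ℝ, 1 ≤ r ∧ ContinuousMap.id X ∈ closure (lipCompactMaps X X r)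

/-- The weak-star topology of `ℒ(Y, X*)`, the dual of the projective tensor product of `Y` and `X`:
the coarsest topology for which `T ↦ ∑ₙ (T yₙ)(xₙ)` is continuous whenever
`∑ₙ ‖yₙ‖ ‖xₙ‖ < ∞`. -/
abbrev weakStarTopology : TopologicalSpace (Y →L[ℝ] StrongDual ℝ X) :=
  TopologicalSpace.induced
    (fun T (p : {p : (ℕ → Y) × (ℕ → X) // Summable fun n => ‖p.1 n‖ * ‖p.2 n‖}) =>
      ∑' n, T (p.1.1 n) (p.1.2 n))
    Pi.topologicalSpace

/-- `T : X* → X*` is weak-star to weak-star continuous. -/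
def IsWeakStarContinuous (T : StrongDual ℝ X →L[ℝ] StrongDual ℝ X) : Prop :=
  Continuous fun φ : WeakDual ℝ X => StrongDual.toWeakDual (T (WeakDual.toStrongDual φ))

/-- `X*` has the bounded weak-star density for compact operators. -/
def DualHasBWStarD : Prop :=
  ∃ r : ℝ, 1 ≤ r ∧
    compactOps (StrongDual ℝ X) (StrongDual ℝ X) 1 ⊆
      closure[weakStarTopology X (StrongDual ℝ X)]
        {T | T ∈ compactOps (StrongDual ℝ X) (StrongDual ℝ X) r ∧ IsWeakStarContinuous X T}

end Properties

end LipAP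

end

namespace LipAP

open Filter Finset

/-! ### Averages over finite grids and their telescoping differences. -/

section Averages

variable {X : Type*} [NormedAddCommGroup X] [NormedSpace ℝ X]

/-! The identity of `X` is approximated by compact linear operators `T` of bounded norm. This
suffices, since the linearization of `T` is `T ∘ β` with `β : 𝔉(X) → X` the barycentre map.

Work on the dual side, where 𝔉(X)* = Lip₀(X). Adjoints of the compact linearizations on `M`,
extended by the ideal operator, give compact maps X* → 𝔉(X)*. Their ultralimit agrees with the
canonical embedding X* → 𝔉(X)* on 𝔉(M), so the difference factors through (𝔉(X)/𝔉(M))*, where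
adjoints of compact operators on the quotient approximate it. Hence the embedding is approximated
pointwise by bounded compact operators (`exists_compact_approx_dual_embedding`).

To return to X*, compose with a projection Lip₀(X) → X*. A general one need not respect pointwise
approximation; the one of `exists_projection_dual` averages difference quotients over grids, so that
its value at a prescribed vector telescopes to boundary values on a compact zonotope. Closeness on a
finite net then suffices.

This gives compact `U` on X* with `U ψ x` near `ψ x`. The density hypothesis replaces `U` by
adjoints of compact operators on `X`, and a Hahn–Banach argument upgrades weak to strong
approximation. -/

/-- The zonotope `{∑ tₛ s : 0 ≤ tₛ ≤ r}` generated by a list of vectors. -/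
def zonotope (r : ℝ) : List X → Set X
  | [] => {0}
  | s :: L => (fun p : ℝ × X => p.1 • s + p.2) '' (Set.Icc 0 r ×ˢ zonotope r L)

theorem isCompact_zonotope (r : ℝ) (L : List X) : IsCompact (zonotope r L) := by
  induction L with
  | nil => exact isCompact_singleton
  | cons s L ih => exact (isCompact_Icc.prod ih).image (by fun_prop)

theorem smul_add_mem_zonotope {r t : ℝ} (h0 : 0 ≤ t) (h1 : t ≤ r) (s : X) {L : List X} {z : X}
    (hz : z ∈ zonotope r L) : t • s + z ∈ zonotope r (s :: L) :=
  ⟨(t, z), ⟨⟨h0, h1⟩, hz⟩, rfl⟩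

theorem norm_le_of_mem_zonotope {r : ℝ} {L : List X} {z : X} (hz : z ∈ zonotope r L) :
    ‖z‖ ≤ r * (L.map norm).sum := by
  induction L generalizing z with
  | nil =>
    obtain rfl : z = 0 := hz
    simp
  | cons s L ih =>
    obtain ⟨⟨t, w⟩, ⟨⟨h0, h1⟩, hw⟩, rfl⟩ := hz
    have h2 : ‖t • s‖ ≤ r * ‖s‖ := by
      rw [norm_smul, Real.norm_of_nonneg h0]
      gcongr
    simp only [List.map_cons, List.sum_cons, mul_add]
    exact (norm_add_le _ _).trans (add_le_add h2 (ih hw))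

/-- The average of `g` over the grid `x + ∑ kₛ h s`, `0 ≤ kₛ < N`, with `s` running through a list
of vectors. -/
noncomputable def gridAverage (N : ℕ) (h : ℝ) : List X → (X → ℝ) → X → ℝ
  | [], g => g
  | s :: L, g => fun x => (∑ k ∈ range N, gridAverage N h L g (x + ((k : ℝ) * h) • s)) / N

theorem gridAverage_add (N : ℕ) (h : ℝ) (L : List X) (f g : X → ℝ) (x : X) :
    gridAverage N h L (fun y => f y + g y) x = gridAverage N h L f x + gridAverage N h L g x := by
  induction L generalizing x with
  | nil => rfl
  | cons s L ih => simp only [gridAverage, ih, sum_add_distrib, add_div]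

theorem gridAverage_mul (N : ℕ) (h : ℝ) (L : List X) (c : ℝ) (g : X → ℝ) (x : X) :
    gridAverage N h L (fun y => c * g y) x = c * gridAverage N h L g x := by
  induction L generalizing x with
  | nil => rfl
  | cons s L ih => simp only [gridAverage, ih, ← mul_sum, mul_div_assoc]

theorem gridAverage_sub (N : ℕ) (h : ℝ) (L : List X) (f g : X → ℝ) (x : X) :
    gridAverage N h L (fun y => f y - g y) x = gridAverage N h L f x - gridAverage N h L g x := by
  have h1 := gridAverage_add N h L f (fun y => -1 * g y) x
  rw [gridAverage_mul] at h1
  simpa [sub_eq_add_neg] using h1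

theorem gridAverage_const {N : ℕ} (hN : 0 < N) (h : ℝ) (L : List X) (c : ℝ) (x : X) :
    gridAverage N h L (fun _ => c) x = c := by
  have : (N : ℝ) ≠ 0 := by positivity
  induction L generalizing x with
  | nil => rfl
  | cons s L ih => simp [gridAverage, ih, this]

theorem gridAverage_translate (N : ℕ) (h : ℝ) (L : List X) (g : X → ℝ) (v x : X) :
    gridAverage N h L (fun y => g (y + v)) x = gridAverage N h L g (x + v) := by
  induction L generalizing x with
  | nil => rfl
  | cons s L ih => simp only [gridAverage, ih, add_right_comm]

theorem abs_sum_div_le {N : ℕ} (hN : 0 < N) {a : ℕ → ℝ} {B : ℝ} (h : ∀ k < N, |a k| ≤ B) :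
    |(∑ k ∈ range N, a k) / N| ≤ B := by
  have hN' : (0 : ℝ) < N := by positivity
  rw [abs_div, abs_of_pos hN', div_le_iff₀ hN']
  refine (abs_sum_le_sum_abs _ _).trans ((sum_le_sum fun k hk => h k (mem_range.1 hk)).trans ?_)
  simp [mul_comm]

theorem abs_gridAverage_le {N : ℕ} (hN : 0 < N) {h : ℝ} (hh : 0 ≤ h) {L : List X} {g : X → ℝ}
    {B : ℝ} {x : X} (hg : ∀ z ∈ zonotope (N * h) L, |g (x + z)| ≤ B) :
    |gridAverage N h L g x| ≤ B := by
  induction L generalizing x with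
  | nil => simpa [gridAverage] using hg 0 rfl
  | cons s L ih =>
    refine abs_sum_div_le hN fun k hk => ih fun z hz => ?_
    rw [add_assoc]
    exact hg _ (smul_add_mem_zonotope (by positivity) (by gcongr) s hz)

/-- Along the direction `s` the sum of differences telescopes to two boundary terms, and the other
directions only average. The upper boundary term sits at `k = N`, outside the grid but still in the
closed zonotope of side `N * h`. -/
theorem abs_gridAverage_difference_le {N : ℕ} (hN : 0 < N) {h : ℝ} (hh : 0 ≤ h) {L : List X}
    {s : X} (hs : s ∈ L) {g : X → ℝ} {B : ℝ} {x : X}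
    (hg : ∀ z ∈ zonotope (N * h) L, |g (x + z)| ≤ B) :
    |gridAverage N h L (fun y => g (y + h • s) - g y) x| ≤ 2 * B / N := by
  induction L generalizing x with
  | nil => simp at hs
  | cons e L ih =>
    have hN' : (0 : ℝ) < N := by positivity
    rcases eq_or_ne s e with rfl | hne
    · have key : gridAverage N h (s :: L) (fun y => g (y + h • s) - g y) x
          = (gridAverage N h L g (x + ((N : ℝ) * h) • s) - gridAverage N h L g x) / N := by
        have := sum_range_sub (fun k : ℕ => gridAverage N h L g (x + ((k : ℝ) * h) • s)) N
        simp only [Nat.cast_zero, zero_mul, zero_smul, add_zero] at this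
        rw [← this, gridAverage]
        refine congrArg (· / (N : ℝ)) (sum_congr rfl fun k _ => ?_)
        rw [gridAverage_sub, gridAverage_translate, add_assoc, ← add_smul]
        congr 4
        push_cast
        ring
      rw [key, abs_div, abs_of_pos hN']
      gcongr
      refine (abs_sub _ _).trans ?_
      rw [two_mul]
      refine add_le_add (abs_gridAverage_le hN hh fun z hz => ?_)
        (abs_gridAverage_le hN hh fun z hz => ?_)
      · rw [add_assoc]
        exact hg _ (smul_add_mem_zonotope (by positivity) le_rfl s hz)
      · simpa using hg _ (smul_add_mem_zonotope le_rfl (by positivity) s hz)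
    · refine abs_sum_div_le hN fun k hk => ih (List.mem_of_ne_of_mem hne hs) fun z hz => ?_
      rw [add_assoc]
      exact hg _ (smul_add_mem_zonotope (by positivity) (by gcongr) e hz)

end Averages

section Ultralimit

theorem exists_tendsto_ultrafilter {ι : Type*} (u : Ultrafilter ι) {f : ι → ℝ} {C : ℝ}
    (h : ∀ᶠ i in u, |f i| ≤ C) : ∃ a, |a| ≤ C ∧ Tendsto f u (𝓝 a) := by
  obtain ⟨a, ha, h'⟩ := (isCompact_Icc (a := -C) (b := C)).ultrafilter_le_nhds (u.map f) (by
    rw [le_principal_iff]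
    exact h.mono fun i hi => abs_le.1 hi)
  exact ⟨a, abs_le.2 ha, h'⟩

end Ultralimit

/-! ### A controlled linear projection of Lip₀(X) onto X*. -/

section Linearization

variable {X : Type*} [NormedAddCommGroup X] [NormedSpace ℝ X]

/-- The difference quotient of `φ` in direction `x` with step `h`, averaged over a grid generated by
`L` with `N` points a side and over one generated by `S` with `m` points a side. -/
noncomputable def averagedSlope (L S : List X) (N m : ℕ) (h : ℝ) (φ : X → ℝ) (x : X) : ℝ :=
  gridAverage m h S (gridAverage N h L fun y => φ (y + h • x) - φ y) 0 / h

theorem averagedSlope_add (L S : List X) (N m : ℕ) (h : ℝ) (φ ψ : X → ℝ) (x : X) :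
    averagedSlope L S N m h (fun y => φ y + ψ y) x
      = averagedSlope L S N m h φ x + averagedSlope L S N m h ψ x := by
  have h1 : gridAverage N h L (fun y => φ (y + h • x) + ψ (y + h • x) - (φ y + ψ y))
      = fun y => gridAverage N h L (fun y => φ (y + h • x) - φ y) y
        + gridAverage N h L (fun y => ψ (y + h • x) - ψ y) y := by
    funext z
    rw [← gridAverage_add]
    congr 1
    funext y
    ring
  rw [averagedSlope, h1, gridAverage_add, add_div]
  rfl

theorem averagedSlope_mul (L S : List X) (N m : ℕ) (h c : ℝ) (φ : X → ℝ) (x : X) :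
    averagedSlope L S N m h (fun y => c * φ y) x = c * averagedSlope L S N m h φ x := by
  have h1 : gridAverage N h L (fun y => c * φ (y + h • x) - c * φ y)
      = fun y => c * gridAverage N h L (fun y => φ (y + h • x) - φ y) y := by
    funext z
    rw [← gridAverage_mul]
    congr 1
    funext y
    ring
  rw [averagedSlope, h1, gridAverage_mul, mul_div_assoc]
  rfl

theorem averagedSlope_dual (L S : List X) {N m : ℕ} (hN : 0 < N) (hm : 0 < m) {h : ℝ}
    (hh : 0 < h) (φ : StrongDual ℝ X) (x : X) : averagedSlope L S N m h φ x = φ x := by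
  have h1 : (gridAverage N h L fun y => φ (y + h • x) - φ y) = fun _ => h * φ x := by
    funext z
    simp [gridAverage_const hN]
  rw [averagedSlope, h1, gridAverage_const hm]
  field_simp

theorem abs_averagedSlope_le (L S : List X) {N m : ℕ} (hN : 0 < N) (hm : 0 < m) {h : ℝ}
    (hh : 0 < h) (φ : Lip0 X) (x : X) : |averagedSlope L S N m h φ x| ≤ ‖φ‖ * ‖x‖ := by
  rw [averagedSlope, abs_div, abs_of_pos hh, div_le_iff₀ hh]
  refine abs_gridAverage_le hm hh.le fun z _ => abs_gridAverage_le hN hh.le fun w _ => ?_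
  refine (φ.norm_sub_le_norm_mul _ _).trans_eq ?_
  rw [add_sub_cancel_left, norm_smul, Real.norm_of_nonneg hh.le]
  ring

/-- The outer average over `S` makes the slope almost additive: the defect is the average of an `h •
s` difference of `G`, which telescopes. As `G` is of size `h * (‖φ‖ * ‖x‖)`, dividing by `h` leaves
a bound of order `1 / m`. -/
theorem abs_averagedSlope_add_sub_le (L : List X) {S : List X} {N m : ℕ} (hN : 0 < N) (hm : 0 < m)
    {h : ℝ} (hh : 0 < h) (φ : Lip0 X) (x : X) {s : X} (hs : s ∈ S) :
    |averagedSlope L S N m h φ (x + s) - averagedSlope L S N m h φ x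
      - averagedSlope L S N m h φ s| ≤ 2 * (‖φ‖ * ‖x‖) / m := by
  set G := gridAverage N h L fun y => φ (y + h • x) - φ y with hG
  have h1 : (gridAverage N h L fun y => φ (y + h • (x + s)) - φ y)
      = fun z => (G (z + h • s) - G z) + G z
        + gridAverage N h L (fun y => φ (y + h • s) - φ y) z := by
    funext z
    rw [hG, sub_add_cancel, ← gridAverage_translate, ← gridAverage_add]
    congr 1
    funext y
    rw [smul_add, add_comm (h • x), ← add_assoc]
    ring
  have h2 : averagedSlope L S N m h φ (x + s) - averagedSlope L S N m h φ x
      - averagedSlope L S N m h φ s = gridAverage m h S (fun z => G (z + h • s) - G z) 0 / h := by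
    simp only [averagedSlope, h1, gridAverage_add, ← hG]
    ring
  rw [h2, abs_div, abs_of_pos hh, div_le_iff₀ hh]
  have h3 : ∀ z, |G z| ≤ h * (‖φ‖ * ‖x‖) := fun z => by
    refine abs_gridAverage_le hN hh.le fun w _ => ?_
    refine (φ.norm_sub_le_norm_mul _ _).trans_eq ?_
    rw [add_sub_cancel_left, norm_smul, Real.norm_of_nonneg hh.le]
    ring
  refine (abs_gridAverage_difference_le hm hh.le hs (fun z _ => h3 _)).trans_eq ?_
  ring

/-- Here the inner average over `L` telescopes, and `N * h = 1` cancels the division by `h`. The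
outer average moves the base point by at most `η`, which costs `‖φ‖ * η`. -/
theorem abs_averagedSlope_le_of_small {L S : List X} {N m : ℕ} (hN : 0 < N) (hm : 0 < m)
    {h : ℝ} (hh : 0 < h) (hNh : N * h = 1) {η : ℝ} (hη : (m * h) * (S.map norm).sum ≤ η)
    (φ : Lip0 X) {ε : ℝ} (hφ : ∀ z ∈ zonotope 1 L, |φ z| ≤ ε) {e : X} (he : e ∈ L) :
    |averagedSlope L S N m h φ e| ≤ 2 * (ε + ‖φ‖ * η) := by
  rw [averagedSlope, abs_div, abs_of_pos hh, div_le_iff₀ hh]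
  refine abs_gridAverage_le hm hh.le fun z hz => ?_
  have h1 : ∀ w ∈ zonotope (N * h) L, |φ (0 + z + w)| ≤ ε + ‖φ‖ * η := fun w hw => by
    rw [hNh] at hw
    have h2 := φ.norm_sub_le_norm_mul (0 + z + w) w
    rw [add_sub_cancel_right, zero_add] at h2
    have h3 : ‖φ‖ * ‖z‖ ≤ ‖φ‖ * η := by
      gcongr
      exact (norm_le_of_mem_zonotope hz).trans hη
    have h4 := abs_sub_abs_le_abs_sub (φ (0 + z + w)) (φ w)
    have h5 := hφ w hw
    rw [zero_add] at h4 ⊢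
    rw [Real.norm_eq_abs] at h2
    linarith
  refine (abs_gridAverage_difference_le hN hh.le he h1).trans_eq ?_
  rw [eq_comm, ← eq_div_iff_mul_eq hh.ne']
  field_simp
  rw [mul_assoc, hNh, mul_one]

/-- A norm-one linear projection of `Lip₀(X)` onto `X*` whose values at prescribed vectors are
controlled by the values of the Lipschitz function on a compact set. -/
theorem exists_projection_dual (L : List X) :
    ∃ π : Lip0 X →L[ℝ] StrongDual ℝ X, ‖π‖ ≤ 1 ∧
      (∀ (φ : Lip0 X) (ψ : StrongDual ℝ X), (∀ x, φ x = ψ x) → π φ = ψ) ∧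
      ∀ (φ : Lip0 X) (ε : ℝ), (∀ z ∈ zonotope 1 L, |φ z| ≤ ε) → ∀ e ∈ L, |π φ e| ≤ 2 * ε := by
  classical
  let u : Ultrafilter (Finset X × ℕ) := Ultrafilter.of atTop
  have hu : (u : Filter (Finset X × ℕ)) ≤ atTop := Ultrafilter.of_le _
  -- With `N = m² k` and `h = 1 / N`, the inner grid has side 1 while the outer one has radius at
  -- most `m h k = 1 / m`. So `m → ∞` restores additivity and makes the outer shift vanish
  -- simultaneously.
  let k : Finset X → ℕ := fun S => ⌈(S.toList.map norm).sum⌉₊ + 1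
  let m : Finset X × ℕ → ℕ := fun i => i.2 + 1
  let N : Finset X × ℕ → ℕ := fun i => m i * m i * k i.1
  let h : Finset X × ℕ → ℝ := fun i => 1 / N i
  have hm : ∀ i, 0 < m i := fun i => Nat.succ_pos _
  have hN : ∀ i, 0 < N i := fun i =>
    Nat.mul_pos (Nat.mul_pos (hm i) (hm i)) (Nat.succ_pos _)
  have hh : ∀ i, 0 < h i := fun i => one_div_pos.2 (Nat.cast_pos.2 (hN i))
  have hmt : Tendsto (fun i => (m i : ℝ)) u atTop := by
    have h1 : Tendsto (fun i : Finset X × ℕ => m i) atTop atTop := by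
      rw [← prod_atTop_atTop_eq]
      exact (tendsto_add_atTop_nat 1).comp tendsto_snd
    exact (tendsto_natCast_atTop_atTop.comp h1).mono_left hu
  let D : Finset X × ℕ → (X → ℝ) → X → ℝ :=
    fun i => averagedSlope L i.1.toList (N i) (m i) (h i)
  have hD : ∀ (φ : Lip0 X) (x : X), ∃ a, |a| ≤ ‖φ‖ * ‖x‖ ∧ Tendsto (fun i => D i φ x) u (𝓝 a) :=
    fun φ x => exists_tendsto_ultrafilter u
      (Eventually.of_forall fun i => abs_averagedSlope_le L _ (hN i) (hm i) (hh i) φ x)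
  choose p hpb hp using hD
  have hadd : ∀ φ x s, p φ (x + s) = p φ x + p φ s := by
    intro φ x s
    have h1 := ((hp φ (x + s)).sub (hp φ x)).sub (hp φ s)
    have h2 : Tendsto (fun i => 2 * (‖φ‖ * ‖x‖) / (m i : ℝ)) u (𝓝 0) :=
      tendsto_const_nhds.div_atTop hmt
    -- Every vector eventually becomes a direction of the outer grid.
    have h3 : ∀ᶠ i in (u : Filter (Finset X × ℕ)), s ∈ i.1 := by
      refine hu ?_
      filter_upwards [eventually_ge_atTop (({s} : Finset X), 0)] with i hi
      exact hi.1 (mem_singleton_self s)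
    have h4 : Tendsto (fun i => D i φ (x + s) - D i φ x - D i φ s) u (𝓝 0) := by
      refine squeeze_zero_norm' ?_ h2
      filter_upwards [h3] with i hi
      exact abs_averagedSlope_add_sub_le L (hN i) (hm i) (hh i) φ x (by simpa using hi)
    have := tendsto_nhds_unique h1 h4
    linarith
  have hsmul : ∀ φ (c : ℝ) x, p φ (c • x) = c * p φ x := by
    intro φ c x
    let q : X →+ ℝ := AddMonoidHom.mk' (p φ) (hadd φ)
    have hq : Continuous q := AddMonoidHomClass.continuous_of_bound q ‖φ‖ (hpb φ)
    exact map_real_smul q hq c x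
  have hadd' : ∀ φ ψ x, p (φ + ψ) x = p φ x + p ψ x := fun φ ψ x =>
    tendsto_nhds_unique (hp (φ + ψ) x) (((hp φ x).add (hp ψ x)).congr fun i =>
      (averagedSlope_add L _ _ _ _ φ ψ x).symm)
  have hsmul' : ∀ (c : ℝ) φ x, p (c • φ) x = c * p φ x := fun c φ x =>
    tendsto_nhds_unique (hp (c • φ) x) (((hp φ x).const_mul c).congr fun i =>
      (averagedSlope_mul L _ _ _ _ c φ x).symm)
  let B : Lip0 X →ₗ[ℝ] X →ₗ[ℝ] ℝ := LinearMap.mk₂ ℝ p hadd' hsmul' hadd fun c φ x => hsmul φ c x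
  refine ⟨B.mkContinuous₂ 1 fun φ x => ?_, LinearMap.mkContinuous₂_norm_le _ zero_le_one _, ?_, ?_⟩
  · rw [one_mul]
    exact hpb φ x
  · intro φ ψ hφ
    ext x
    refine tendsto_nhds_unique (hp φ x) (tendsto_const_nhds.congr fun i => ?_)
    have : (φ : X → ℝ) = ψ := funext hφ
    rw [this]
    exact (averagedSlope_dual L _ (hN i) (hm i) (hh i) ψ x).symm
  · intro φ ε hφ e he
    have h1 : Tendsto (fun i => 2 * (ε + ‖φ‖ * (1 / (m i : ℝ)))) u (𝓝 (2 * (ε + ‖φ‖ * 0))) :=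
      ((((tendsto_const_nhds (x := (1 : ℝ))).div_atTop hmt).const_mul _).const_add _).const_mul _
    rw [mul_zero, add_zero] at h1
    refine le_of_tendsto_of_tendsto' (hp φ e).abs h1 fun i => ?_
    refine abs_averagedSlope_le_of_small (hN i) (hm i) (hh i) ?_ ?_ φ hφ he
    · exact mul_one_div_cancel (Nat.cast_ne_zero.2 (hN i).ne')
    · have h2 : (i.1.toList.map norm).sum ≤ (k i.1 : ℝ) :=
        (Nat.le_ceil _).trans (by simp [k])
      have h3 : (0 : ℝ) < k i.1 := Nat.cast_pos.2 (Nat.succ_pos _)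
      have h4 : (0 : ℝ) < m i := Nat.cast_pos.2 (hm i)
      calc (m i : ℝ) * h i * (i.1.toList.map norm).sum ≤ m i * h i * k i.1 := by
            have := (hh i).le
            gcongr
        _ = 1 / m i := by
            simp only [h, N]
            push_cast
            field_simp

end Linearization

end LipAP

namespace LipAP

/-! ### Schauder's theorem, preadjoints, and passage from weak to strong approximation. -/

section CompactOperators

variable {E F : Type*} [NormedAddCommGroup E] [NormedSpace ℝ E] [NormedAddCommGroup F]
  [NormedSpace ℝ F]

theorem isCompactOperator_of_totallyBounded [CompleteSpace F] (T : E →L[ℝ] F)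
    (h : TotallyBounded (T '' Metric.closedBall 0 1)) : IsCompactOperator T :=
  (isCompactOperator_iff_isCompact_closure_image_closedBall (T : E →ₗ[ℝ] F) zero_lt_one).2
    (h.closure.isCompact_of_isClosed isClosed_closure)

theorem totallyBounded_image_closedBall {T : E →L[ℝ] F} (h : IsCompactOperator T) :
    TotallyBounded (T '' Metric.closedBall 0 1) :=
  ((isCompactOperator_iff_isCompact_closure_image_closedBall (T : E →ₗ[ℝ] F)
    zero_lt_one).1 h).totallyBounded.subset subset_closure

/-- Schauder's theorem: the adjoint of a compact operator is compact. -/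
theorem isCompactOperator_precomp {T : E →L[ℝ] F} (h : IsCompactOperator T) :
    IsCompactOperator (T.precomp ℝ : StrongDual ℝ F →L[ℝ] StrongDual ℝ E) := by
  refine isCompactOperator_of_totallyBounded _ (Metric.totallyBounded_iff.2 fun ε hε => ?_)
  obtain ⟨t, -, htf, ht⟩ := Metric.finite_approx_of_totallyBounded
    (totallyBounded_image_closedBall h) (ε / 5) (by positivity)
  have := htf.fintype
  -- Restricting functionals to a finite net of the image of the ball reduces the claim to total
  -- boundedness in finite dimension.
  let Φ : StrongDual ℝ F → t → ℝ := fun φ y => φ y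
  have hΦ : TotallyBounded (Φ '' Metric.closedBall 0 1) := by
    have h1 : TotallyBounded (Set.univ.pi fun y : t => Set.Icc (-‖(y : F)‖) ‖(y : F)‖) :=
      (isCompact_univ_pi fun _ => isCompact_Icc).totallyBounded
    refine h1.subset ?_
    rintro _ ⟨φ, hφ, rfl⟩ y -
    refine abs_le.1 ?_
    have h2 : ‖φ‖ ≤ 1 := by simpa using hφ
    exact (φ.le_opNorm y).trans (mul_le_of_le_one_left (norm_nonneg _) h2)
  obtain ⟨s, hs, hsf, hcov⟩ := Metric.finite_approx_of_totallyBounded hΦ (ε / 5) (by positivity)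
  obtain ⟨s', hs', hsf', rfl⟩ := Set.exists_subset_image_finite_and.1 ⟨s, hs, hsf, rfl⟩
  refine ⟨T.precomp ℝ '' s', hsf'.image _, ?_⟩
  rintro _ ⟨φ, hφ, rfl⟩
  obtain ⟨_, ⟨ψ, hψ, rfl⟩, hd⟩ := Set.mem_iUnion₂.1 (hcov ⟨φ, hφ, rfl⟩)
  refine Set.mem_iUnion₂.2 ⟨_, ⟨ψ, hψ, rfl⟩, ?_⟩
  have h1 : ‖φ‖ ≤ 1 := by simpa using hφ
  have h2 : ‖ψ‖ ≤ 1 := by simpa using hs' hψ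
  rw [Metric.mem_ball, dist_eq_norm, ← map_sub]
  refine lt_of_le_of_lt (ContinuousLinearMap.opNorm_le_of_unit_norm (C := 4 * (ε / 5))
    (by positivity) fun x hx => ?_) (by linarith)
  obtain ⟨y, hy, hxy⟩ := Set.mem_iUnion₂.1 (ht ⟨x, by simp [hx], rfl⟩)
  rw [Metric.mem_ball, dist_eq_norm] at hxy
  have h3 : ‖φ y - ψ y‖ < ε / 5 := by
    have := (dist_pi_lt_iff (by positivity)).1 hd ⟨y, hy⟩
    rwa [dist_eq_norm] at this
  have h4 : ‖φ (T x - y)‖ ≤ ε / 5 :=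
    (φ.le_opNorm _).trans ((mul_le_of_le_one_left (norm_nonneg _) h1).trans hxy.le)
  have h5 : ‖ψ (T x - y)‖ ≤ ε / 5 :=
    (ψ.le_opNorm _).trans ((mul_le_of_le_one_left (norm_nonneg _) h2).trans hxy.le)
  have h6 : (T.precomp ℝ (φ - ψ)) x = φ (T x - y) + (φ y - ψ y) - ψ (T x - y) := by
    simp
  rw [h6]
  refine (norm_sub_le _ _).trans ?_
  linarith [norm_add_le (φ (T x - y)) (φ y - ψ y)]

theorem isCompactOperator_of_linearIsometry_comp {G : Type*} [NormedAddCommGroup G]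
    [NormedSpace ℝ G] [CompleteSpace F] (i : F →ₗᵢ[ℝ] G) {T : E →L[ℝ] F}
    (h : IsCompactOperator (i.toContinuousLinearMap ∘L T)) : IsCompactOperator T := by
  refine isCompactOperator_of_totallyBounded _ ((totallyBounded_preimage
    i.isometry.isUniformInducing (totallyBounded_image_closedBall h)).subset ?_)
  rintro _ ⟨x, hx, rfl⟩
  exact ⟨x, hx, rfl⟩

variable {X : Type*} [NormedAddCommGroup X] [NormedSpace ℝ X]

/-- A weak-star continuous compact operator on a dual space is the adjoint of a compact operator. -/
theorem exists_compact_preadjoint [CompleteSpace X] {R : StrongDual ℝ X →L[ℝ] StrongDual ℝ X}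
    (hw : IsWeakStarContinuous X R) (hc : IsCompactOperator R) :
    ∃ T : X →L[ℝ] X, IsCompactOperator T ∧ ‖T‖ ≤ ‖R‖ ∧ ∀ φ x, φ (T x) = R φ x := by
  have h1 : ∀ x : X, ∃ y : X, ∀ φ : StrongDual ℝ X, φ y = R φ x := fun x => by
    let f : WeakDual ℝ X →L[ℝ] ℝ :=
      { toFun := fun φ => R (WeakDual.toStrongDual φ) x
        map_add' := fun a b => by simp
        map_smul' := fun a b => by simp
        cont := (WeakDual.eval_continuous x).comp hw }
    -- Weak-star continuous functionals on X* are evaluations at points of `X`.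
    obtain ⟨y, hy⟩ := LinearMap.dualEmbedding_surjective (topDualPairing ℝ X) f
    exact ⟨y, fun φ => congrArg (fun g : WeakDual ℝ X →L[ℝ] ℝ => g (StrongDual.toWeakDual φ)) hy⟩
  choose t ht using h1
  have hext : ∀ {a b : X}, (∀ φ : StrongDual ℝ X, φ a = φ b) → a = b := fun h =>
    (SeparatingDual.eq_iff_forall_dual_eq (R := ℝ)).2 h
  let T : X →L[ℝ] X := LinearMap.mkContinuous
    { toFun := t
      map_add' := fun a b => hext fun φ => by simp [ht]
      map_smul' := fun a b => hext fun φ => by simp [ht] } ‖R‖ fun x => by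
    refine NormedSpace.norm_le_dual_bound ℝ _ (by positivity) fun φ => ?_
    change ‖φ (t x)‖ ≤ _
    rw [ht]
    refine ((R φ).le_opNorm x).trans ?_
    have := R.le_opNorm φ
    calc ‖R φ‖ * ‖x‖ ≤ (‖R‖ * ‖φ‖) * ‖x‖ := by gcongr
      _ = _ := by ring
  refine ⟨T, ?_, LinearMap.mkContinuous_norm_le _ (norm_nonneg R) _, fun φ x => ht x φ⟩
  -- Inside the bidual, `T` is the restriction of the adjoint of `R`, so Schauder's theorem applies.
  refine isCompactOperator_of_linearIsometry_comp (G := StrongDual ℝ (StrongDual ℝ X))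
    (NormedSpace.inclusionInDoubleDualLi ℝ) ?_
  have h2 : (NormedSpace.inclusionInDoubleDualLi ℝ).toContinuousLinearMap ∘L T
      = (R.precomp ℝ) ∘L (NormedSpace.inclusionInDoubleDual ℝ X) := by
    ext x φ
    exact ht x φ
  rw [h2]
  exact (isCompactOperator_precomp hc).comp_clm _

theorem exists_compact_approx_of_dualHasBWStarD [CompleteSpace X] (hX : DualHasBWStarD X) :
    ∃ r : ℝ, 1 ≤ r ∧ ∀ U : StrongDual ℝ X →L[ℝ] StrongDual ℝ X, IsCompactOperator U → ‖U‖ ≤ 1 →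
      ∀ (s : Finset X) (ψ : X → StrongDual ℝ X) (ε : ℝ), 0 < ε →
        ∃ T ∈ compactOps X X r, ∀ x ∈ s, |ψ x (T x) - U (ψ x) x| < ε := by
  classical
  obtain ⟨r, hr, h⟩ := hX
  refine ⟨r, hr, fun U hU hU1 s ψ ε hε => ?_⟩
  have h1 := closure_induced.1 (h ⟨hU, hU1⟩)
  -- The elementary tensor `ψ x ⊗ x`, as a sequence supported at 0, tests the weak-star topology.
  let p : X → {p : (ℕ → StrongDual ℝ X) × (ℕ → X) // Summable fun n => ‖p.1 n‖ * ‖p.2 n‖} :=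
    fun x => ⟨(Pi.single 0 (ψ x), Pi.single 0 x),
      summable_of_ne_finset_zero (s := {0}) fun n hn => by simp_all⟩
  have hp : ∀ (T : StrongDual ℝ X →L[ℝ] StrongDual ℝ X) (x : X),
      ∑' n, T ((p x).1.1 n) ((p x).1.2 n) = T (ψ x) x := fun T x => by
    rw [tsum_eq_single 0 fun n hn => by simp [p, hn]]
    simp [p]
  obtain ⟨_, hR, ⟨R, ⟨⟨hRc, hRr⟩, hRw⟩, rfl⟩⟩ := mem_closure_iff.1 h1
    (⋂ x ∈ s, {f | |f (p x) - U (ψ x) x| < ε})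
    (isOpen_biInter_finset fun x _ =>
      isOpen_lt (((continuous_apply (p x)).sub continuous_const).abs) continuous_const)
    (Set.mem_iInter₂.2 fun x _ => by simpa [hp] using hε)
  obtain ⟨T, hTc, hTR, hT⟩ := exists_compact_preadjoint hRw hRc
  refine ⟨T, ⟨hTc, hTR.trans hRr⟩, fun x hx => ?_⟩
  have h2 : |∑' n, R ((p x).1.1 n) ((p x).1.2 n) - U (ψ x) x| < ε := Set.mem_iInter₂.1 hR x hx
  rwa [hp, ← hT] at h2

theorem convex_compactOps (r : ℝ) : Convex ℝ (compactOps E F r) := by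
  rintro S ⟨hS, hS'⟩ T ⟨hT, hT'⟩ a b ha hb hab
  refine ⟨(hS.smul a).add (hT.smul b), ?_⟩
  refine (norm_add_le _ _).trans ?_
  rw [norm_smul, norm_smul, Real.norm_of_nonneg ha, Real.norm_of_nonneg hb]
  calc a * ‖S‖ + b * ‖T‖ ≤ a * r + b * r := by gcongr
    _ = r := by rw [← add_mul, hab, one_mul]

/-- If the identity is in the closure of a ball of compact operators for the weak operator topology,
it is so for the strong operator topology. -/
theorem exists_compactOps_norm_sub_lt {r : ℝ}
    (h : ∀ (s : Finset X) (ψ : X → StrongDual ℝ X) (ε : ℝ), 0 < ε →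
      ∃ T ∈ compactOps X X r, ∀ x ∈ s, |ψ x (T x) - ψ x x| < ε)
    (s : Finset X) {ε : ℝ} (hε : 0 < ε) : ∃ T ∈ compactOps X X r, ∀ x ∈ s, ‖T x - x‖ < ε := by
  classical
  let ev : (X →L[ℝ] X) →ₗ[ℝ] (s → X) :=
    LinearMap.pi fun x => (ContinuousLinearMap.apply ℝ X (x : X)).toLinearMap
  have hcl : (fun x : s => (x : X)) ∈ closure (ev '' compactOps X X r) := by
    by_contra hn
    -- Mazur's argument in the finite power `s → X`: a separating functional is a finite sum of
    -- functionals on the coordinates, which the weak hypothesis controls.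
    have hconv : Convex ℝ (closure (ev '' compactOps X X r)) :=
      ((convex_compactOps (E := X) (F := X) r).linear_image ev).closure
    obtain ⟨f, u, hfu, huf⟩ := geometric_hahn_banach_closed_point (E := s → X)
      hconv isClosed_closure hn
    let ψ : X → StrongDual ℝ X := fun x =>
      if hx : x ∈ s then f ∘L ContinuousLinearMap.single ℝ (fun _ : s => X) ⟨x, hx⟩ else 0
    have hf : ∀ v : s → X, f v = ∑ x : s, ψ x (v x) := fun v => by
      conv_lhs => rw [← Finset.univ_sum_single v, map_sum]
      refine Finset.sum_congr rfl fun x _ => ?_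
      simp [ψ]
    set d := f (fun x : s => (x : X)) - u with hd
    have hd0 : 0 < d := sub_pos.2 huf
    obtain ⟨T, hT, hTs⟩ := h s ψ (d / (s.card + 1)) (by positivity)
    have h1 := hfu _ (subset_closure ⟨T, hT, rfl⟩)
    have h2 : |f (ev T) - f (fun x : s => (x : X))| ≤ s.card * (d / (s.card + 1)) := by
      rw [hf, hf, ← Finset.sum_sub_distrib]
      refine (Finset.abs_sum_le_sum_abs _ _).trans ?_
      refine (Finset.sum_le_sum fun (x : s) _ => (hTs x.1 x.2).le).trans ?_
      simp
    have h3 : s.card * (d / (s.card + 1)) < d := by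
      rw [mul_div_assoc', div_lt_iff₀ (by positivity)]
      nlinarith
    linarith [(abs_le.1 h2).1]
  obtain ⟨_, ⟨T, hT, rfl⟩, hd⟩ := Metric.mem_closure_iff.1 hcl ε hε
  refine ⟨T, hT, fun x hx => ?_⟩
  have := (dist_pi_lt_iff hε).1 hd ⟨x, hx⟩
  rwa [dist_comm, dist_eq_norm] at this

end CompactOperators

end LipAP

namespace LipAP

/-! ### Lipschitz-free spaces: duality, barycentre and subspaces. -/

section Lift

variable {F G H : Type*} [NormedAddCommGroup F] [NormedSpace ℝ F] [NormedAddCommGroup G]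
  [NormedSpace ℝ G] [NormedAddCommGroup H] [NormedSpace ℝ H]

theorem exists_lift_linearIsometry (i : F →ₗᵢ[ℝ] G) (A : H →L[ℝ] G)
    (h : ∀ x, A x ∈ LinearMap.range i.toLinearMap) : ∃ B : H →L[ℝ] F, ∀ x, i (B x) = A x := by
  choose b hb using h
  have hb' : ∀ x, i (b x) = A x := hb
  refine ⟨LinearMap.mkContinuous
    { toFun := b
      map_add' := fun x y => i.injective (by simp [hb'])
      map_smul' := fun c x => i.injective (by simp [hb']) } ‖A‖ fun x => ?_, hb⟩
  change ‖b x‖ ≤ _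
  rw [← i.norm_map, hb']
  exact A.le_opNorm x

theorem isClosed_range_linearIsometry [CompleteSpace F] (i : F →ₗᵢ[ℝ] G) :
    IsClosed (LinearMap.range i.toLinearMap : Set G) := by
  rw [LinearMap.coe_range]
  exact i.isometry.isClosedEmbedding.isClosed_range

end Lift

section FreeSpace

variable {X : Type*} [NormedAddCommGroup X]

instance : CompleteSpace (FreeSpace X) :=
  (Submodule.isClosed_topologicalClosure _).completeSpace_coe

/-- The inclusion of the Lipschitz-free space in the dual of `Lip₀(X)`. -/
noncomputable def FreeSpace.incl : FreeSpace X →ₗᵢ[ℝ] StrongDual ℝ (Lip0 X) :=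
  (freeSubmodule X).subtypeₗᵢ

/-- Density of the span of the evaluations, in the form used to extend facts from the points `delta
x` to all of 𝔉(X). -/
theorem FreeSpace.mem_of_delta_mem {S : Submodule ℝ (FreeSpace X)}
    (hS : IsClosed (S : Set (FreeSpace X))) (h : ∀ x, delta x ∈ S) (z : FreeSpace X) : z ∈ S := by
  have h1 : IsClosed ((S.map (FreeSpace.incl (X := X)).toLinearMap :
      Submodule ℝ (StrongDual ℝ (Lip0 X))) : Set (StrongDual ℝ (Lip0 X))) :=
    FreeSpace.incl.isometry.isClosedEmbedding.isClosedMap _ hS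
  have h2 : freeSubmodule X ≤ S.map (FreeSpace.incl (X := X)).toLinearMap := by
    refine Submodule.topologicalClosure_minimal _ (Submodule.span_le.2 ?_) h1
    rintro _ ⟨x, rfl⟩
    exact ⟨delta x, h x, rfl⟩
  have hz : FreeSpace.incl z ∈ freeSubmodule X := z.2
  obtain ⟨w, hw, hwz⟩ := h2 hz
  rwa [← FreeSpace.incl.injective hwz]

theorem norm_delta_sub_le (x y : X) : ‖delta x - delta y‖ ≤ ‖x - y‖ := by
  rw [← FreeSpace.incl.norm_map]
  refine ContinuousLinearMap.opNorm_le_bound _ (norm_nonneg _) fun φ => ?_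
  rw [mul_comm]
  exact φ.norm_sub_le_norm_mul x y

theorem delta_zero : delta (0 : X) = 0 :=
  FreeSpace.incl.injective (ContinuousLinearMap.ext fun φ => φ.map_zero)

/-- The functional on the Lipschitz-free space given by a Lipschitz function. -/
noncomputable def Lip0.toDual : Lip0 X →L[ℝ] StrongDual ℝ (FreeSpace X) :=
  (FreeSpace.incl (X := X)).toContinuousLinearMap.flip

theorem Lip0.toDual_delta (φ : Lip0 X) (x : X) : Lip0.toDual φ (delta x) = φ x := rfl

theorem Lip0.norm_toDual_le (φ : Lip0 X) : ‖Lip0.toDual φ‖ ≤ ‖φ‖ :=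
  ContinuousLinearMap.opNorm_le_bound _ (norm_nonneg _) fun z => by
    rw [mul_comm, ← FreeSpace.incl.norm_map z]
    exact (FreeSpace.incl z).le_opNorm φ

/-- An element of `Lip₀(X)` from a function with a Lipschitz bound. -/
def Lip0.mk (f : X → ℝ) (h0 : f 0 = 0) (C : ℝ) (h : ∀ x y, ‖f x - f y‖ ≤ C * ‖x - y‖) : Lip0 X :=
  ⟨f, h0, C, h⟩

/-- The Lipschitz function given by a functional on the Lipschitz-free space. -/
noncomputable def Lip0.ofDual : StrongDual ℝ (FreeSpace X) →L[ℝ] Lip0 X :=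
  LinearMap.mkContinuous
    { toFun := fun ζ => Lip0.mk (fun x => ζ (delta x)) (by simp [delta_zero]) ‖ζ‖ fun x y => by
        rw [← _root_.map_sub]
        exact (ζ.le_opNorm _).trans (by gcongr; exact norm_delta_sub_le x y)
      map_add' := fun _ _ => rfl
      map_smul' := fun _ _ => rfl } 1 fun ζ => by
    rw [one_mul]
    refine Lip0.norm_le_of_bound _ (norm_nonneg _) fun x y => ?_
    change ‖ζ (delta x) - ζ (delta y)‖ ≤ _
    rw [← _root_.map_sub]
    exact (ζ.le_opNorm _).trans (by gcongr; exact norm_delta_sub_le x y)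

theorem Lip0.ofDual_apply (ζ : StrongDual ℝ (FreeSpace X)) (x : X) :
    Lip0.ofDual ζ x = ζ (delta x) := rfl

theorem Lip0.norm_ofDual_le : ‖(Lip0.ofDual : StrongDual ℝ (FreeSpace X) →L[ℝ] Lip0 X)‖ ≤ 1 :=
  LinearMap.mkContinuous_norm_le _ zero_le_one _

variable [NormedSpace ℝ X]

/-- A continuous linear functional as an element of `Lip₀(X)`. -/
noncomputable def Lip0.ofStrongDual : StrongDual ℝ X →L[ℝ] Lip0 X :=
  LinearMap.mkContinuous
    { toFun := fun ψ => Lip0.mk ψ (_root_.map_zero ψ) ‖ψ‖ fun x y => by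
        rw [← _root_.map_sub]
        exact ψ.le_opNorm _
      map_add' := fun _ _ => rfl
      map_smul' := fun _ _ => rfl } 1 fun ψ => by
    rw [one_mul]
    refine Lip0.norm_le_of_bound _ (norm_nonneg _) fun x y => ?_
    change ‖ψ x - ψ y‖ ≤ _
    rw [← _root_.map_sub]
    exact ψ.le_opNorm _

/-- The barycentre map `β : 𝔉(X) → X`. -/
theorem exists_barycenter [CompleteSpace X] :
    ∃ β : FreeSpace X →L[ℝ] X, ∀ x, β (delta x) = x := by
  let i := NormedSpace.inclusionInDoubleDualLi ℝ (E := X)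
  -- Restricting elements of 𝔉(X) to linear functionals lands in X**. Evaluations land in `X`, which
  -- is closed there by completeness.
  let A : FreeSpace X →L[ℝ] StrongDual ℝ (StrongDual ℝ X) :=
    (Lip0.ofStrongDual (X := X)).precomp ℝ ∘L FreeSpace.incl.toContinuousLinearMap
  have hi : IsClosed (LinearMap.range i.toLinearMap : Set (StrongDual ℝ (StrongDual ℝ X))) :=
    isClosed_range_linearIsometry (G := StrongDual ℝ (StrongDual ℝ X)) i
  have hcl : IsClosed ((LinearMap.range i.toLinearMap).comap A.toLinearMap : Set (FreeSpace X)) :=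
    (hi).preimage A.continuous
  obtain ⟨β, hβ⟩ := exists_lift_linearIsometry (G := StrongDual ℝ (StrongDual ℝ X)) i A
    (FreeSpace.mem_of_delta_mem hcl fun x => ⟨x, rfl⟩)
  exact ⟨β, fun x => i.injective (hβ _)⟩

/-- McShane's extension theorem. -/
theorem exists_lip0_extension (M : Submodule ℝ X) (φ : Lip0 M) :
    ∃ φ' : Lip0 X, (∀ m : M, φ' m = φ m) ∧ ‖φ'‖ ≤ ‖φ‖ := by
  classical
  let g : X → ℝ := fun x => if hx : x ∈ M then φ ⟨x, hx⟩ else 0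
  have hg : LipschitzOnWith ⟨‖φ‖, norm_nonneg φ⟩ g M := by
    refine LipschitzOnWith.of_dist_le_mul fun x hx y hy => ?_
    rw [SetLike.mem_coe] at hx hy
    simp only [g, hx, hy, dif_pos, dist_eq_norm]
    exact φ.norm_sub_le_norm_mul ⟨x, hx⟩ ⟨y, hy⟩
  obtain ⟨f, hf, hfg⟩ := hg.extend_real
  have h1 : ∀ m : M, f m = φ m := fun m => by
    rw [← hfg m.2]
    simp [g]
  have h2 : ∀ x y, ‖f x - f y‖ ≤ ‖φ‖ * ‖x - y‖ := fun x y => by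
    rw [← dist_eq_norm, ← dist_eq_norm]
    exact hf.dist_le_mul x y
  have h3 : f 0 = 0 := (h1 0).trans φ.map_zero
  exact ⟨Lip0.mk f h3 _ h2, h1, Lip0.norm_le_of_bound _ (norm_nonneg _) h2⟩

/-- Restriction of Lipschitz functions to a subspace. -/
noncomputable def Lip0.restrict (M : Submodule ℝ X) : Lip0 X →L[ℝ] Lip0 M :=
  LinearMap.mkContinuous
    { toFun := fun φ => Lip0.mk (fun m => φ m) φ.map_zero ‖φ‖ fun x y =>
        φ.norm_sub_le_norm_mul x y
      map_add' := fun _ _ => rfl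
      map_smul' := fun _ _ => rfl } 1 fun φ => by
    rw [one_mul]
    exact Lip0.norm_le_of_bound _ (norm_nonneg _) fun x y => φ.norm_sub_le_norm_mul x y

/-- The map is dual to restriction Lip₀(X) → Lip₀(M). It is isometric because Lipschitz functions
extend from `M` without increase of norm. -/
theorem exists_freeSpace_embedding (M : Submodule ℝ X) :
    ∃ i : FreeSpace M →ₗᵢ[ℝ] FreeSpace X, ∀ m : M, i (delta m) = delta (m : X) := by
  let A : FreeSpace M →L[ℝ] StrongDual ℝ (Lip0 X) :=
    (Lip0.restrict M).precomp ℝ ∘L FreeSpace.incl.toContinuousLinearMap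
  have hcl : IsClosed ((LinearMap.range (FreeSpace.incl (X := X)).toLinearMap).comap A.toLinearMap :
      Set (FreeSpace M)) :=
    (isClosed_range_linearIsometry FreeSpace.incl).preimage A.continuous
  obtain ⟨B, hB⟩ := exists_lift_linearIsometry FreeSpace.incl A
    (FreeSpace.mem_of_delta_mem hcl fun m => ⟨delta (m : X), rfl⟩)
  have hA : ∀ z, ‖A z‖ = ‖z‖ := fun z => by
    rw [← FreeSpace.incl.norm_map z]
    refine le_antisymm ?_ ?_
    · refine ContinuousLinearMap.opNorm_le_bound _ (norm_nonneg _) fun φ => ?_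
      refine ((FreeSpace.incl z).le_opNorm _).trans ?_
      gcongr
      exact Lip0.norm_le_of_bound _ (norm_nonneg _) fun x y => φ.norm_sub_le_norm_mul x y
    · refine ContinuousLinearMap.opNorm_le_bound _ (norm_nonneg _) fun φ => ?_
      obtain ⟨φ', h1, h2⟩ := exists_lip0_extension M φ
      have h3 : A z φ' = FreeSpace.incl z φ :=
        congrArg (FreeSpace.incl z) (Lip0.ext h1)
      rw [← h3]
      exact ((A z).le_opNorm _).trans (by gcongr)
  exact ⟨⟨B.toLinearMap, fun z => by
      rw [← hA, ← hB, LinearIsometry.norm_map]; rfl⟩, fun m => FreeSpace.incl.injective (hB _)⟩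

/-- The identification of the subspace `𝔉(M)` of `𝔉(X)` with the Lipschitz-free space of `M`. -/
theorem exists_freeSubspace_to_freeSpace (M : Submodule ℝ X) :
    ∃ J : freeSubspace M →L[ℝ] FreeSpace M, ‖J‖ ≤ 1 ∧
      ∀ (m : M) (h : delta (m : X) ∈ freeSubspace M), J ⟨delta (m : X), h⟩ = delta m := by
  obtain ⟨i, hi⟩ := exists_freeSpace_embedding M
  have h1 : freeSubspace M ≤ LinearMap.range i.toLinearMap := by
    refine Submodule.topologicalClosure_minimal _ (Submodule.span_le.2 ?_)
      (isClosed_range_linearIsometry i)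
    rintro _ ⟨m, hm, rfl⟩
    exact ⟨delta ⟨m, hm⟩, hi ⟨m, hm⟩⟩
  obtain ⟨J, hJ⟩ := exists_lift_linearIsometry i (freeSubspace M).subtypeL fun z => h1 z.2
  refine ⟨J, ContinuousLinearMap.opNorm_le_bound _ zero_le_one fun z => ?_, fun m h => ?_⟩
  · rw [← i.norm_map, hJ, one_mul]
    rfl
  · exact i.injective ((hJ _).trans (hi m).symm)

end FreeSpace

end LipAP

namespace LipAP

open Filter

section FreeSpace

variable {X : Type*} [NormedAddCommGroup X]

/-- A functional on 𝔉(X) is determined by the Lipschitz function it induces, and its norm is at most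
the Lipschitz norm. -/
theorem norm_le_of_delta_bound {ζ : StrongDual ℝ (FreeSpace X)} {C : ℝ} (hC : 0 ≤ C)
    (h : ∀ x y, ‖ζ (delta x) - ζ (delta y)‖ ≤ C * ‖x - y‖) : ‖ζ‖ ≤ C := by
  let η : StrongDual ℝ (FreeSpace X) := ζ - Lip0.toDual (Lip0.ofDual ζ)
  have h1 : ∀ z, z ∈ LinearMap.ker η.toLinearMap := FreeSpace.mem_of_delta_mem η.isClosed_ker
    fun x => by
      change ζ (delta x) - Lip0.toDual (Lip0.ofDual ζ) (delta x) = 0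
      rw [Lip0.toDual_delta, Lip0.ofDual_apply, sub_self]
  have h2 : ζ = Lip0.toDual (Lip0.ofDual ζ) := ContinuousLinearMap.ext fun z => sub_eq_zero.1 (h1 z)
  rw [h2]
  exact (Lip0.norm_toDual_le _).trans (Lip0.norm_le_of_bound _ hC h)

theorem norm_linearization_le {Y : Type*} [NormedAddCommGroup Y] [NormedSpace ℝ Y]
    {L : FreeSpace X →L[ℝ] Y} {C : ℝ} (hC : 0 ≤ C)
    (h : ∀ x y, ‖L (delta x) - L (delta y)‖ ≤ C * ‖x - y‖) : ‖L‖ ≤ C := by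
  refine L.opNorm_le_bound hC fun z => NormedSpace.norm_le_dual_bound ℝ _ (by positivity) fun ψ => ?_
  have h1 : ‖ψ ∘L L‖ ≤ ‖ψ‖ * C := norm_le_of_delta_bound (by positivity) fun x y => by
    rw [ContinuousLinearMap.comp_apply, ContinuousLinearMap.comp_apply, ← map_sub, mul_assoc]
    exact (ψ.le_opNorm _).trans (by gcongr; exact h x y)
  calc ‖ψ (L z)‖ ≤ ‖ψ ∘L L‖ * ‖z‖ := (ψ ∘L L).le_opNorm z
    _ ≤ (‖ψ‖ * C) * ‖z‖ := by gcongr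
    _ = C * ‖z‖ * ‖ψ‖ := by ring

end FreeSpace

/-! ### Compact approximation on the dual side and descent to `X`. -/

section Approximation

variable {X : Type*} [NormedAddCommGroup X] [NormedSpace ℝ X]

/-- The composition of the adjoint of the linearization of a map on `M` with an extension
operator. -/
theorem exists_compact_extension_adjoint {M : Submodule ℝ X} (hideal : IsIdeal (freeSubspace M))
    {r : ℝ} (hr : 0 ≤ r) {f : C(M, M)} (hf : f ∈ lipCompactMaps M M r) :
    ∃ a : StrongDual ℝ X →L[ℝ] StrongDual ℝ (FreeSpace X), IsCompactOperator a ∧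
      (∀ ψ, ‖a ψ‖ ≤ r * ‖ψ‖) ∧ ∀ ψ (m : M), a ψ (delta (m : X)) = ψ (f m) := by
  obtain ⟨σ, hσ⟩ := hideal
  obtain ⟨-, hflip, L, hL, hLc⟩ := hf
  obtain ⟨J, hJ1, hJ⟩ := exists_freeSubspace_to_freeSpace M
  have hLr : ‖L‖ ≤ r := norm_linearization_le hr fun x y => by
    rw [hL, hL]
    exact hflip x y
  have hJ' : ∀ z, ‖J z‖ ≤ ‖z‖ := fun z => (J.le_opNorm z).trans
    (mul_le_of_le_one_left (norm_nonneg _) hJ1)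
  let S : StrongDual ℝ X →L[ℝ] StrongDual ℝ (freeSubspace M) :=
    (J.precomp ℝ ∘L L.precomp ℝ) ∘L M.subtypeL.precomp ℝ
  have hS : ∀ ψ z, S ψ z = ψ (L (J z)) := fun _ _ => rfl
  refine ⟨σ ∘L S, ?_, fun ψ => ?_, fun ψ m => ?_⟩
  · exact (((isCompactOperator_precomp hLc).clm_comp (J.precomp ℝ)).comp_clm
      (M.subtypeL.precomp ℝ)).clm_comp σ
  · rw [ContinuousLinearMap.comp_apply, (hσ _).2]
    refine ContinuousLinearMap.opNorm_le_bound _ (by positivity) fun z => ?_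
    rw [hS]
    have h1 : ‖(L (J z) : X)‖ ≤ r * ‖z‖ := by
      refine (L.le_opNorm (J z)).trans ?_
      gcongr
      exact hJ' z
    calc ‖ψ (L (J z))‖ ≤ ‖ψ‖ * ‖(L (J z) : X)‖ := ψ.le_opNorm _
      _ ≤ ‖ψ‖ * (r * ‖z‖) := by gcongr
      _ = r * ‖ψ‖ * ‖z‖ := by ring
  · have hm : delta (m : X) ∈ freeSubspace M :=
      Submodule.le_topologicalClosure _ (Submodule.subset_span ⟨m, m.2, rfl⟩)
    have h1 := (hσ (S ψ)).1 ⟨delta (m : X), hm⟩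
    rw [hS, hJ, hL] at h1
    exact h1

/-- A uniformly bounded family of operators into a dual space has a limit along an ultrafilter, in
the weak-star operator topology. -/
theorem exists_weakStar_ultralimit {ι E F : Type*} [NormedAddCommGroup E] [NormedSpace ℝ E]
    [NormedAddCommGroup F] [NormedSpace ℝ F] (u : Ultrafilter ι) (a : ι → E →L[ℝ] StrongDual ℝ F)
    {r : ℝ} (h : ∀ᶠ i in u, ∀ x, ‖a i x‖ ≤ r * ‖x‖) :
    ∃ b : E →L[ℝ] StrongDual ℝ F, ∀ x y, Tendsto (fun i => a i x y) u (𝓝 (b x y)) := by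
  have h1 : ∀ x y, ∃ c, |c| ≤ r * ‖x‖ * ‖y‖ ∧ Tendsto (fun i => a i x y) u (𝓝 c) := fun x y =>
    exists_tendsto_ultrafilter u (h.mono fun i hi =>
      ((a i x).le_opNorm y).trans (by gcongr; exact hi x))
  choose b hb hlim using h1
  refine ⟨LinearMap.mkContinuous₂ (LinearMap.mk₂ ℝ b (fun x x' y => ?_) (fun c x y => ?_)
    (fun x y y' => ?_) (fun c x y => ?_)) r hb, hlim⟩
  · exact tendsto_nhds_unique (hlim _ _) (((hlim x y).add (hlim x' y)).congr fun i => by simp)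
  · exact tendsto_nhds_unique (hlim _ _) (((hlim x y).const_smul c).congr fun i => by simp)
  · exact tendsto_nhds_unique (hlim _ _) (((hlim x y).add (hlim x y')).congr fun i => by simp)
  · exact tendsto_nhds_unique (hlim _ _) (((hlim x y).const_smul c).congr fun i => by simp)

/-- A bounded family of functionals vanishing on `N` factors through the quotient by `N`. -/
theorem exists_quotient_factorization {E Z : Type*} [NormedAddCommGroup E] [NormedSpace ℝ E]
    [NormedAddCommGroup Z] [NormedSpace ℝ Z] (N : Submodule ℝ Z) [IsClosed (N : Set Z)]
    (b : E →L[ℝ] StrongDual ℝ Z) (h : ∀ x, ∀ z ∈ N, b x z = 0) :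
    ∃ c : E →L[ℝ] StrongDual ℝ (Z ⧸ N), (∀ x z, c x (N.mkQL z) = b x z) ∧
      ∀ x y, ‖c x y‖ ≤ ‖b‖ * ‖x‖ * ‖y‖ := by
  let q : E → Z ⧸ N → ℝ := fun x => N.liftQL (b x) (h x)
  have hq : ∀ x z, q x (N.mkQ z) = b x z := fun _ _ => rfl
  have hb : ∀ x y, ‖q x y‖ ≤ ‖b‖ * ‖x‖ * ‖y‖ := fun x y => by
    refine le_of_forall_pos_le_add fun ε hε => ?_
    have hd : 0 < ‖b‖ * ‖x‖ + 1 := by positivity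
    -- The quotient norm is an infimum, so a nearly optimal representative is used; the `+ 1` keeps
    -- the denominator positive.
    obtain ⟨z, rfl, hz⟩ := QuotientAddGroup.exists_norm_mk_lt (S := N.toAddSubgroup) y
      (div_pos hε hd)
    calc ‖b x z‖ ≤ ‖b‖ * ‖x‖ * ‖z‖ := b.le_opNorm₂ x z
      _ ≤ ‖b‖ * ‖x‖ * (‖(z : Z ⧸ N.toAddSubgroup)‖ + ε / (‖b‖ * ‖x‖ + 1)) := by gcongr
      _ ≤ ‖b‖ * ‖x‖ * ‖(z : Z ⧸ N.toAddSubgroup)‖ + ε := by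
        rw [mul_add]
        gcongr
        rw [mul_div_assoc', div_le_iff₀ hd]
        nlinarith
  refine ⟨LinearMap.mkContinuous₂ (LinearMap.mk₂ ℝ q (fun x x' y => ?_) (fun c x y => ?_)
    (fun x y y' => map_add _ y y') (fun c x y => map_smul _ c y)) ‖b‖ hb, fun _ _ => rfl, hb⟩
  · obtain ⟨z, rfl⟩ := N.mkQ_surjective y
    rw [hq, hq, hq, map_add]
    rfl
  · obtain ⟨z, rfl⟩ := N.mkQ_surjective y
    rw [hq, hq, map_smul]
    rfl

/-- The canonical embedding of `X*` in `𝔉(X)*` is approximated by a bounded family of compact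
operators. -/
theorem exists_compact_approx_dual_embedding (M : Submodule ℝ X)
    (hideal : IsIdeal (freeSubspace M)) (hLip : HasLipKBAP M)
    (hquot : HasKBAP (FreeSpace X ⧸ freeSubspace M)) :
    ∃ C : ℝ, 1 ≤ C ∧ ∀ (s : Finset X) (t : Finset (StrongDual ℝ X)) (ε : ℝ), 0 < ε →
      ∃ G : StrongDual ℝ X →L[ℝ] StrongDual ℝ (FreeSpace X), IsCompactOperator G ∧ ‖G‖ ≤ C ∧
        ∀ x ∈ s, ∀ ψ ∈ t, |G ψ (delta x) - ψ x| < ε := by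
  classical
  obtain ⟨r, hr, hcl⟩ := hLip
  obtain ⟨r', hr', hcl'⟩ := hquot
  obtain ⟨u, hu, hu'⟩ := mem_closure_iff_ultrafilter.1 hcl
  have h1 : ∀ f : C(M, M), ∃ a : StrongDual ℝ X →L[ℝ] StrongDual ℝ (FreeSpace X),
      f ∈ lipCompactMaps M M r → IsCompactOperator a ∧
      (∀ ψ, ‖a ψ‖ ≤ r * ‖ψ‖) ∧ ∀ ψ (m : M), a ψ (delta (m : X)) = ψ (f m) := fun f => by
    by_cases hf : f ∈ lipCompactMaps M M r
    · obtain ⟨a, ha⟩ := exists_compact_extension_adjoint hideal (by linarith) hf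
      exact ⟨a, fun _ => ha⟩
    · exact ⟨0, fun h => absurd h hf⟩
  choose a ha using h1
  have hu : ∀ᶠ f in (u : Filter C(M, M)), f ∈ lipCompactMaps M M r := hu
  obtain ⟨a', ha'⟩ := exists_weakStar_ultralimit u a (hu.mono fun f hf => (ha f hf).2.1)
  -- The part of the canonical embedding missed by the ultralimit. It vanishes on 𝔉(M) because the
  -- maps `f` converge to the identity of `M`.
  let b : StrongDual ℝ X →L[ℝ] StrongDual ℝ (FreeSpace X) :=
    Lip0.toDual ∘L Lip0.ofStrongDual - a'
  have hb : ∀ ψ x, b ψ (delta x) = ψ x - a' ψ (delta x) := fun _ _ => rfl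
  have hbN : ∀ ψ, ∀ z ∈ freeSubspace M, b ψ z = 0 := fun ψ => by
    have : freeSubspace M ≤ LinearMap.ker (b ψ).toLinearMap := by
      refine Submodule.topologicalClosure_minimal _ (Submodule.span_le.2 ?_) (b ψ).isClosed_ker
      rintro _ ⟨m, hm, rfl⟩
      have h2 : Tendsto (fun f : C(M, M) => ψ (f ⟨m, hm⟩)) u (𝓝 (ψ m)) := by
        have : Continuous fun f : C(M, M) => ψ (f ⟨m, hm⟩) :=
          ψ.continuous.comp (continuous_subtype_val.comp (continuous_eval_const _))
        exact (this.tendsto (ContinuousMap.id M)).mono_left hu'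
      have h3 := tendsto_nhds_unique_of_eventuallyEq (ha' ψ (delta m)) h2
        (hu.mono fun f hf => (ha f hf).2.2 ψ ⟨m, hm⟩)
      change b ψ (delta m) = 0
      rw [hb, h3, sub_self]
    exact this
  obtain ⟨c, hc, hcb⟩ := exists_quotient_factorization (freeSubspace M) b hbN
  refine ⟨r + ‖b‖ * r', by nlinarith [norm_nonneg b], fun s t ε hε => ?_⟩
  have h4 : ∀ᶠ f in (u : Filter C(M, M)), ∀ x ∈ s, ∀ ψ ∈ t,
      |a f ψ (delta x) - a' ψ (delta x)| < ε / 2 := by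
    refine (eventually_all_finset s).2 fun x _ => (eventually_all_finset t).2 fun ψ _ => ?_
    have := (ha' ψ (delta x)).eventually (Metric.ball_mem_nhds _ (half_pos hε))
    exact this
  obtain ⟨f, hf, hf'⟩ := (hu.and h4).exists
  let Q := (freeSubspace M).mkQL
  obtain ⟨_, hT', ⟨T, ⟨hTc, hTr⟩, rfl⟩⟩ := mem_closure_iff.1 hcl'
    (⋂ x ∈ s, ⋂ ψ ∈ t, {g | |c ψ (g (Q (delta x))) - c ψ (Q (delta x))| < ε / 2})
    (isOpen_biInter_finset fun x _ => isOpen_biInter_finset fun ψ _ =>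
      isOpen_lt ((((c ψ).continuous.comp (continuous_eval_const _)).sub continuous_const).abs)
        continuous_const)
    (by simp [hε])
  have hT : ∀ x ∈ s, ∀ ψ ∈ t, |c ψ (T (Q (delta x))) - c ψ (Q (delta x))| < ε / 2 :=
    fun x hx ψ hψ => Set.mem_iInter₂.1 (Set.mem_iInter₂.1 hT' x hx) ψ hψ
  obtain ⟨hac, har, -⟩ := ha f hf
  -- The first term approximates `a'`, the second approximates `b`; together they approximate the
  -- embedding.
  refine ⟨a f + (Q.precomp ℝ ∘L T.precomp ℝ) ∘L c, ?_, ?_, fun x hx ψ hψ => ?_⟩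
  · exact hac.add (((isCompactOperator_precomp hTc).clm_comp (Q.precomp ℝ)).comp_clm c)
  · refine ContinuousLinearMap.opNorm_le_bound _ (by positivity) fun ψ => ?_
    rw [add_mul]
    refine (norm_add_le _ _).trans (add_le_add (har ψ) ?_)
    refine ContinuousLinearMap.opNorm_le_bound _ (by positivity) fun z => ?_
    have h5 : ‖Q z‖ ≤ ‖z‖ := Submodule.Quotient.norm_mk_le _ z
    calc ‖c ψ (T (Q z))‖ ≤ ‖b‖ * ‖ψ‖ * ‖T (Q z)‖ := hcb _ _
      _ ≤ ‖b‖ * ‖ψ‖ * (r' * ‖z‖) := by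
        gcongr
        exact (T.le_opNorm _).trans (by gcongr)
      _ = ‖b‖ * r' * ‖ψ‖ * ‖z‖ := by ring
  · have h6 : (a f + (Q.precomp ℝ ∘L T.precomp ℝ) ∘L c) ψ (delta x) - ψ x
        = (a f ψ (delta x) - a' ψ (delta x)) + (c ψ (T (Q (delta x))) - c ψ (Q (delta x))) := by
      rw [hc, hb]
      change a f ψ (delta x) + c ψ (T (Q (delta x))) - ψ x = _
      ring
    rw [h6]
    linarith [abs_add_le (a f ψ (delta x) - a' ψ (delta x))
      (c ψ (T (Q (delta x))) - c ψ (Q (delta x))), hf' x hx ψ hψ, hT x hx ψ hψ]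

/-- If the canonical embedding of `X*` in `𝔉(X)*` is approximated by a bounded family of compact
operators, then so is the identity of `X*`, in the weak-star operator topology. -/
theorem exists_compact_approx_dual_id {C : ℝ} (hC : 1 ≤ C)
    (hG : ∀ (s : Finset X) (t : Finset (StrongDual ℝ X)) (ε : ℝ), 0 < ε →
      ∃ G : StrongDual ℝ X →L[ℝ] StrongDual ℝ (FreeSpace X), IsCompactOperator G ∧ ‖G‖ ≤ C ∧
        ∀ x ∈ s, ∀ ψ ∈ t, |G ψ (delta x) - ψ x| < ε)
    (s : Finset X) (ψ : X → StrongDual ℝ X) {ε : ℝ} (hε : 0 < ε) :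
    ∃ U : StrongDual ℝ X →L[ℝ] StrongDual ℝ X, IsCompactOperator U ∧ ‖U‖ ≤ C ∧
      ∀ x ∈ s, |U (ψ x) x - ψ x x| < ε := by
  classical
  obtain ⟨π, hπ1, hπid, hπ⟩ := exists_projection_dual s.toList
  set B : ℝ := ∑ x ∈ s, ‖ψ x‖ with hB
  have hB0 : 0 ≤ B := Finset.sum_nonneg fun _ _ => norm_nonneg _
  have hψB : ∀ x ∈ s, ‖ψ x‖ ≤ B := fun x hx =>
    Finset.single_le_sum (f := fun x => ‖ψ x‖) (fun _ _ => norm_nonneg _) hx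
  have hd : 0 < (C + 1) * B + 1 := by positivity
  -- The Lipschitz bound `(C + 1) * B` on the error turns closeness `ε / 8` on this net into `ε / 4`
  -- on the zonotope, and the projection doubles that to `ε / 2`.
  obtain ⟨K, -, hKf, hK⟩ := Metric.finite_approx_of_totallyBounded
    (isCompact_zonotope 1 s.toList).totallyBounded (ε / 8 / ((C + 1) * B + 1)) (by positivity)
  obtain ⟨G, hGc, hGC, hGs⟩ := hG hKf.toFinset (s.image ψ) (ε / 8) (by positivity)
  refine ⟨π ∘L Lip0.ofDual ∘L G, (hGc.clm_comp Lip0.ofDual).clm_comp π, ?_, fun x hx => ?_⟩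
  · refine (ContinuousLinearMap.opNorm_comp_le _ _).trans ?_
    refine (mul_le_of_le_one_left (norm_nonneg _) hπ1).trans ?_
    refine (ContinuousLinearMap.opNorm_comp_le _ _).trans ?_
    exact (mul_le_of_le_one_left (norm_nonneg _) Lip0.norm_ofDual_le).trans hGC
  · let φ : Lip0 X := Lip0.ofDual (G (ψ x)) - Lip0.ofStrongDual (ψ x)
    have hφ : ∀ z, φ z = G (ψ x) (delta z) - ψ x z := fun _ => rfl
    have h1 : π φ = π (Lip0.ofDual (G (ψ x))) - ψ x := by
      rw [map_sub, hπid (Lip0.ofStrongDual (ψ x)) (ψ x) fun _ => rfl]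
    have h2 : ‖φ‖ ≤ (C + 1) * B := by
      refine Lip0.norm_le_of_bound _ (by positivity) fun y z => ?_
      have h3 : φ y - φ z = G (ψ x) (delta y - delta z) - ψ x (y - z) := by
        rw [hφ, hφ, map_sub, map_sub]
        ring
      rw [h3]
      have h4 : ‖G (ψ x) (delta y - delta z)‖ ≤ C * B * ‖y - z‖ := by
        refine (G.le_opNorm₂ _ _).trans ?_
        gcongr
        · exact hψB x hx
        · exact norm_delta_sub_le y z
      have h5 : ‖ψ x (y - z)‖ ≤ B * ‖y - z‖ :=
        ((ψ x).le_opNorm _).trans (by gcongr; exact hψB x hx)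
      linarith [norm_sub_le (G (ψ x) (delta y - delta z)) (ψ x (y - z))]
    have h6 : ∀ z ∈ zonotope 1 s.toList, |φ z| ≤ ε / 4 := fun z hz => by
      obtain ⟨w, hw, hzw⟩ := Set.mem_iUnion₂.1 (hK hz)
      rw [Metric.mem_ball, dist_eq_norm] at hzw
      have h7 : |φ w| < ε / 8 :=
        hGs w (hKf.mem_toFinset.2 hw) (ψ x) (Finset.mem_image_of_mem ψ hx)
      have h8 : |φ z - φ w| ≤ ε / 8 := by
        refine (φ.norm_sub_le_norm_mul z w).trans ?_
        calc ‖φ‖ * ‖z - w‖ ≤ ((C + 1) * B) * (ε / 8 / ((C + 1) * B + 1)) := by gcongr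
          _ ≤ ε / 8 := by
            rw [mul_div_assoc', div_le_iff₀ hd]
            nlinarith
      linarith [abs_sub_abs_le_abs_sub (φ z) (φ w)]
    have h9 := hπ φ (ε / 4) h6 x (Finset.mem_toList.2 hx)
    rw [h1] at h9
    change |π (Lip0.ofDual (G (ψ x))) x - ψ x x| ≤ _ at h9
    change |π (Lip0.ofDual (G (ψ x))) x - ψ x x| < _
    linarith

/-- A compact linear `T` has compact linearization `T ∘ β`. The uniform norm bound turns
approximation on a finite net into approximation on a compact set, `T - 1` being `(r +
1)`-Lipschitz. -/
theorem hasLipKBAP_of_finite_approx [CompleteSpace X] {r : ℝ} (hr : 1 ≤ r)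
    (h : ∀ (s : Finset X) (ε : ℝ), 0 < ε → ∃ T ∈ compactOps X X r, ∀ x ∈ s, ‖T x - x‖ < ε) :
    HasLipKBAP X := by
  obtain ⟨β, hβ⟩ := exists_barycenter (X := X)
  refine ⟨r, hr, ?_⟩
  refine (mem_closure_iff_nhds_basis (nhds_basis_uniformity'
    (Metric.uniformity_basis_dist (α := X)).compactConvergenceUniformity)).2 ?_
  rintro ⟨K, ε⟩ ⟨hK, hε⟩
  change 0 < ε at hε
  have hr0 : 0 < r + 1 := by linarith
  obtain ⟨t, -, htf, ht⟩ := Metric.finite_approx_of_totallyBounded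
    hK.totallyBounded (ε / 2 / (r + 1)) (by positivity)
  obtain ⟨T, ⟨hTc, hTr⟩, hT⟩ := h htf.toFinset (ε / 2) (by positivity)
  refine ⟨(T : C(X, X)), ⟨map_zero T, fun x y => ?_, T ∘L β, fun x => ?_, hTc.comp_clm β⟩,
    fun x hx => ?_⟩
  · change ‖T x - T y‖ ≤ _
    rw [← map_sub]
    exact (T.le_opNorm _).trans (by gcongr)
  · exact congrArg T (hβ x)
  · obtain ⟨w, hw, hxw⟩ := Set.mem_iUnion₂.1 (ht hx)
    rw [Metric.mem_ball, dist_eq_norm] at hxw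
    have h1 := hT w (htf.mem_toFinset.2 hw)
    change dist x (T x) < ε
    rw [dist_comm, dist_eq_norm]
    have h2 : T x - x = (T w - w) + (T (x - w) - (x - w)) := by
      rw [map_sub]
      abel
    have h3 : ‖T (x - w)‖ ≤ r * ‖x - w‖ := (T.le_opNorm _).trans (by gcongr)
    have h4 : (r + 1) * ‖x - w‖ < ε / 2 := by
      rwa [lt_div_iff₀ hr0, mul_comm] at hxw
    rw [h2]
    linarith [norm_add_le (T w - w) (T (x - w) - (x - w)), norm_sub_le (T (x - w)) (x - w)]

end Approximation

end LipAP

theorem mainTheorem10 {X : Type*} [NormedAddCommGroup X] [NormedSpace ℝ X] [CompleteSpace X]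
    (M : Submodule ℝ X) (hM : IsClosed (M : Set X))
    (hideal : LipAP.IsIdeal (LipAP.freeSubspace M))
    (hLip : LipAP.HasLipKBAP M)
    (hquot : LipAP.HasKBAP (LipAP.FreeSpace X ⧸ LipAP.freeSubspace M))
    (hdual : LipAP.DualHasBWStarD X) :
    LipAP.HasLipKBAP X := by
  obtain ⟨C, hC, hG⟩ := LipAP.exists_compact_approx_dual_embedding M hideal hLip hquot
  obtain ⟨r, hr, hR⟩ := LipAP.exists_compact_approx_of_dualHasBWStarD hdual
  have hC0 : 0 < C := by linarith
  refine LipAP.hasLipKBAP_of_finite_approx (r := C * r) (by nlinarith) fun s ε hε =>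
    LipAP.exists_compactOps_norm_sub_lt (fun s ψ ε hε => ?_) s hε
  obtain ⟨U, hUc, hUC, hU⟩ := LipAP.exists_compact_approx_dual_id hC hG s ψ (half_pos hε)
  -- The density property concerns the unit ball, so `U` is scaled by `C⁻¹` and `T` scaled back,
  -- giving the radius `C * r`.
  obtain ⟨T, ⟨hTc, hTr⟩, hT⟩ := hR (C⁻¹ • U) (hUc.smul C⁻¹) (by
    refine ContinuousLinearMap.opNorm_le_bound _ zero_le_one fun φ => ?_
    rw [smul_apply, norm_smul, norm_inv, Real.norm_of_nonneg hC0.le, one_mul, inv_mul_le_iff₀ hC0]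
    exact (U.le_opNorm φ).trans (by gcongr)) s ψ (ε / 2 / C) (by positivity)
  refine ⟨C • T, ⟨hTc.smul C, ?_⟩, fun x hx => ?_⟩
  · rw [norm_smul, Real.norm_of_nonneg hC0.le]
    gcongr
  · have h1 := hT x hx
    rw [lt_div_iff₀ hC0, ← abs_of_pos hC0, ← abs_mul, abs_of_pos hC0] at h1
    have h2 : (ψ x (T x) - (C⁻¹ • U) (ψ x) x) * C = ψ x ((C • T) x) - U (ψ x) x := by
      simp only [smul_apply, map_smul, smul_eq_mul]
      field_simp
    rw [h2] at h1
    have h3 := hU x hx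
    linarith [abs_sub_le (ψ x ((C • T) x)) (U (ψ x) x) (ψ x x)]
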